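/- Let $X_1,X_2,X_3$ be independent standard exponential random variables (density $e^{-x}\mathbf 1_{x>0}$), let $$S=\{a\in\mathbb R^3:\ a_1+a_2+a_3=0,\ a_1^2+a_2^2+a_3^2=1\},$$ and let $$x_1=\Big(\tfrac1{\sqrt6},\tfrac1{\sqrt6},-\tfrac2{\sqrt6}\Big)\in S,\qquad x_2=\Big(\tfrac1{\sqrt2},-\tfrac1{\sqrt2},0\Big)\in S.$$ For real $q>-1$ and $a\in S$ put $f_q(a)=\mathbb E\,|a_1X_1+a_2X_2+a_3X_3|^q$; this expectation is finite. Then: (i) for $q\in(-1,0)\cup(2,4)$, $f_q$ attains its minimum over $S$ at $x_1$ and its maximum over $S$ at $x_2$; (ii) for $q\in(0,2)\cup(4,6)$, $f_q$ attains its minimum over $S$ at $x_2$ and its maximum over $S$ at $x_1$; (iii) for every integer $q=k>3$, $f_k$ attains its minimum over $S$ at $x_2$ and its maximum over $S$ at $x_1$; (iv) for $q=2$ and for $q=4$, $f_q$ is constant on $S$. -/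

import Mathlib

open MeasureTheory ProbabilityTheory

/-- The constraint set: centred vectors of `ℝ³` on the unit Euclidean sphere. -/
def centredSphere : Set (Fin 3 → ℝ) :=
  {a | ∑ i, a i = 0 ∧ ∑ i, a i ^ 2 = 1}

/-- The integrand `|a₁ X₁ + a₂ X₂ + a₃ X₃| ^ q`. For `q < 0` the value `0 ^ q` is irrelevant in the
situation studied here, since a nontrivial linear combination of independent exponential variables
vanishes with probability zero. -/
noncomputable def absPow {Ω : Type*} (X : Fin 3 → Ω → ℝ) (q : ℝ) (a : Fin 3 → ℝ) (ω : Ω) : ℝ :=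
  |∑ i, a i * X i ω| ^ q

/-- The absolute moment `𝔼 |a₁ X₁ + a₂ X₂ + a₃ X₃| ^ q`. -/
noncomputable def absMoment {Ω : Type*} [MeasurableSpace Ω] (P : Measure Ω)
    (X : Fin 3 → Ω → ℝ) (q : ℝ) (a : Fin 3 → ℝ) : ℝ :=
  ∫ ω, absPow X q a ω ∂P

/-- The vector `(1, 1, -2) / √6`. -/
noncomputable def vecOne : Fin 3 → ℝ :=
  ![1 / Real.sqrt 6, 1 / Real.sqrt 6, -2 / Real.sqrt 6]

/-- The vector `(1, -1, 0) / √2`. -/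
noncomputable def vecTwo : Fin 3 → ℝ :=
  ![1 / Real.sqrt 2, -1 / Real.sqrt 2, 0]

/-- `f` attains its minimum over `S` at the point `x` of `S`. -/
def AttainsMinAt (f : (Fin 3 → ℝ) → ℝ) (S : Set (Fin 3 → ℝ)) (x : Fin 3 → ℝ) : Prop :=
  x ∈ S ∧ IsMinOn f S x

/-- `f` attains its maximum over `S` at the point `x` of `S`. -/
def AttainsMaxAt (f : (Fin 3 → ℝ) → ℝ) (S : Set (Fin 3 → ℝ)) (x : Fin 3 → ℝ) : Prop :=
  x ∈ S ∧ IsMaxOn f S x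

/-! Both f_q(a) - f_q(x₂) and f_q(x₁) - f_q(a) have, weakly, the sign of q(q - 2)(q - 4) for every q
> -1 and a ∈ S. All the extremal claims are read off from this; q = 2 and q = 4 are computed.

Permutations and a global sign bring a to (α, β, -(α + β)) with 0 ≤ β ≤ α and α² + αβ + β² = 1/2;
here β = α is x₁ and β = 0 is x₂. Partial fractions of the characteristic function write the law as
a signed mixture of scaled exponential laws, plus a Gamma(2) law when β = α gives a double pole.
Hence f_q(a)/Γ(q + 1) is an exponential sum in the variable q, with frequencies log α, log β, log (α
+ β) if β < α (`integrable_and_absMoment_centredVec`), and with an affine coefficient if β = α.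

Differences of such sums vanish at q = 0, 2, 4, because the normalised moments there are 1, α² + αβ
+ β² and its square. A Descartes rule of signs (`HasDescartesSign.of_deriv_sub`) shows that these
zeros, together with q = -2 in the comparison with x₁, exhaust the possible sign changes and fixes
the sign between them (`genericMoment_sub_mul_nonneg`, `sub_genericMoment_mul_nonneg`). -/

/-! ### Descartes' rule of signs for exponential sums -/

/-- A function which has, at `x`, the sign of `∏ i, (x - z i)` whenever it vanishes
at the increasing sequence `z` of length `n`. -/
def HasDescartesSign (n : ℕ) (f : ℝ → ℝ) : Prop :=
  ∀ z : Fin n → ℝ, StrictMono z → (∀ i, f (z i) = 0) → ∀ x, 0 ≤ f x * ∏ i, (x - z i)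

lemma hasDescartesSign_zero {f : ℝ → ℝ} (hf : ∀ x, 0 ≤ f x) : HasDescartesSign 0 f :=
  fun z _ _ x ↦ by simpa using hf x

/-- The n points cut the line into n + 1 closed gaps, and j indexes one containing x. Applied to
critical points interlacing n + 1 zeros, it selects the zero lying in the same gap as x. -/
lemma exists_separating_index {n : ℕ} {w : Fin n → ℝ} (hw : StrictMono w) (x : ℝ) :
    ∃ j : Fin (n + 1), ∀ i : Fin n, (i.castSucc < j → w i ≤ x) ∧ (j ≤ i.castSucc → x ≤ w i) := by
  classical
  by_cases h : ∃ k : ℕ, ∃ hk : k < n, x ≤ w ⟨k, hk⟩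
  · obtain ⟨hk, hx⟩ := Nat.find_spec h
    refine ⟨⟨Nat.find h, by omega⟩, fun i ↦ ⟨fun hi ↦ ?_, fun hi ↦ ?_⟩⟩
    · have := Nat.find_min h (m := i) (by simpa [Fin.lt_def] using hi)
      push Not at this
      exact (this i.2).le
    · exact hx.trans (hw.monotone (by simpa [Fin.le_def] using hi))
  · push Not at h
    refine ⟨Fin.last n, fun i ↦ ⟨fun _ ↦ (h i i.2).le, fun hi ↦ ?_⟩⟩
    simp [Fin.le_def] at hi
    omega

/-- Mean value theorem between `b` and `x` in a symmetric form. -/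
lemma exists_sub_eq_deriv_mul {f f' : ℝ → ℝ} (hf : ∀ x, HasDerivAt f (f' x) x) {b x : ℝ}
    (h : x ≠ b) : ∃ ξ, min b x < ξ ∧ ξ < max b x ∧ f x - f b = f' ξ * (x - b) := by
  have hc : Continuous f := continuous_iff_continuousAt.2 fun x ↦ (hf x).continuousAt
  rcases h.lt_or_gt with h | h
  · obtain ⟨ξ, hξ, e⟩ := exists_hasDerivAt_eq_slope f f' h hc.continuousOn fun x _ ↦ hf x
    refine ⟨ξ, by simpa [h.le] using hξ.1, by simpa [h.le] using hξ.2, ?_⟩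
    rw [e]
    field_simp [(sub_pos.2 h).ne']
    ring
  · obtain ⟨ξ, hξ, e⟩ := exists_hasDerivAt_eq_slope f f' h hc.continuousOn fun x _ ↦ hf x
    refine ⟨ξ, by simpa [h.le] using hξ.1, by simpa [h.le] using hξ.2, ?_⟩
    rw [e]
    field_simp [(sub_pos.2 h).ne']

/-- Rolle's theorem yields zeros w of f' interlacing the zeros z of f. If z j lies in the same gap
of w as x, then f x = f' ξ * (x - z j) with ξ in that gap, and the sign of f' ξ, known from w,
agrees with that of the product of the remaining factors. -/
lemma HasDescartesSign.of_deriv {n : ℕ} {f f' : ℝ → ℝ} (hf : ∀ x, HasDerivAt f (f' x) x)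
    (h : HasDescartesSign n f') : HasDescartesSign (n + 1) f := by
  intro z hz hz0 x
  have hc : Continuous f := continuous_iff_continuousAt.2 fun x ↦ (hf x).continuousAt
  have rolle (i : Fin n) : ∃ w, z i.castSucc < w ∧ w < z i.succ ∧ f' w = 0 := by
    obtain ⟨w, hw, e⟩ := exists_hasDerivAt_eq_zero (hz i.castSucc_lt_succ) hc.continuousOn
      (by rw [hz0, hz0]) fun x _ ↦ hf x
    exact ⟨w, hw.1, hw.2, e⟩
  choose w hw1 hw2 hw0 using rolle
  have hw : StrictMono w := by
    intro i j hij
    have : z i.succ ≤ z j.castSucc := hz.monotone (by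
      rw [Fin.le_def, Fin.val_succ, Fin.val_castSucc]; exact hij)
    linarith [hw1 j, hw2 i]
  obtain ⟨j, hj⟩ := exists_separating_index hw x
  rw [Fin.prod_univ_succAbove _ j]
  by_cases hx : x = z j
  · simp [hx]
  obtain ⟨ξ, h1, h2, e⟩ := exists_sub_eq_deriv_mul hf hx
  rw [hz0, sub_zero] at e
  -- Factor by factor: x and ξ lie in the gap containing z j, hence on the same side of w i and of
  -- the zero paired with it.
  have key : 0 < ∏ i, ((x - z (j.succAbove i)) * (ξ - w i)) := by
    refine Finset.prod_pos fun i _ ↦ ?_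
    rcases lt_or_ge i.castSucc j with hi | hi
    · rw [Fin.succAbove_of_castSucc_lt _ _ hi]
      have a1 := (hj i).1 hi
      have a2 : z i.succ ≤ z j := hz.monotone (by
        rw [Fin.le_def, Fin.val_succ]; exact hi)
      have a3 : w i ≤ min (z j) x := le_min (by linarith [hw2 i]) a1
      exact mul_pos (by linarith [hw1 i]) (by linarith)
    · rw [Fin.succAbove_of_le_castSucc _ _ hi]
      have a1 := (hj i).2 hi
      have a2 : z j ≤ z i.castSucc := hz.monotone hi
      have a3 : max (z j) x ≤ w i := max_le (by linarith [hw1 i]) a1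
      exact mul_pos_of_neg_of_neg (by linarith [hw2 i]) (by linarith)
  have hg := h w hw hw0 ξ
  rw [Finset.prod_mul_distrib] at key
  set A := ∏ i, (x - z (j.succAbove i))
  set B := ∏ i, (ξ - w i)
  have hA : 0 ≤ f' ξ * A := by
    have : 0 ≤ (f' ξ * A) * B ^ 2 := by
      have := mul_nonneg hg key.le
      linarith
    have hB : B ≠ 0 := fun hB ↦ by simp [hB] at key
    exact nonneg_of_mul_nonneg_left this (by positivity)
  rw [e]
  have := mul_nonneg hA (sq_nonneg (x - z j))
  linarith

/-- Descartes' rule: applying `d/dx - l` loses at most one zero. -/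
lemma HasDescartesSign.of_deriv_sub {n : ℕ} {f f' : ℝ → ℝ} (l : ℝ)
    (hf : ∀ x, HasDerivAt f (f' x) x) (h : HasDescartesSign n fun x ↦ f' x - l * f x) :
    HasDescartesSign (n + 1) f := by
  -- The factor exp (-l x) turns d/dx - l into d/dx and changes neither zeros nor signs.
  have hd (x : ℝ) : HasDerivAt (fun x ↦ Real.exp (-l * x) * f x)
      (Real.exp (-l * x) * (f' x - l * f x)) x := by
    have h1 : HasDerivAt (fun x : ℝ ↦ Real.exp (-l * x)) (Real.exp (-l * x) * (-l)) x := by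
      simpa using ((hasDerivAt_id x).const_mul (-l)).exp
    exact (h1.mul (hf x)).congr_deriv (by ring)
  have hs : HasDescartesSign n fun x ↦ Real.exp (-l * x) * (f' x - l * f x) := by
    intro z hz hz0 x
    rw [mul_assoc]
    exact mul_nonneg (Real.exp_pos _).le
      (h z hz (fun i ↦ by simpa [(Real.exp_pos _).ne'] using hz0 i) x)
  intro z hz hz0 x
  have := HasDescartesSign.of_deriv hd hs z hz (fun i ↦ by simp [hz0 i]) x
  rw [mul_assoc] at this
  exact nonneg_of_mul_nonneg_right this (Real.exp_pos _)

/-- An exponential sum with five frequencies, one of them having an affine coefficient. -/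
noncomputable def expSum (l₁ l₂ l₃ l₄ l₅ c₁ u v c₃ c₄ c₅ x : ℝ) : ℝ :=
  c₁ * Real.exp (l₁ * x) + (u + v * x) * Real.exp (l₂ * x) + c₃ * Real.exp (l₃ * x)
    + c₄ * Real.exp (l₄ * x) + c₅ * Real.exp (l₅ * x)

/-- The operator d/dx - l multiplies each constant coefficient by its frequency minus l. It
therefore kills a simple frequency l and lowers the degree of an affine coefficient at l. -/
lemma HasDescartesSign.expSum {n : ℕ} {l₁ l₂ l₃ l₄ l₅ c₁ u v c₃ c₄ c₅ : ℝ} (l : ℝ)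
    (h : HasDescartesSign n (expSum l₁ l₂ l₃ l₄ l₅ ((l₁ - l) * c₁) ((l₂ - l) * u + v)
      ((l₂ - l) * v) ((l₃ - l) * c₃) ((l₄ - l) * c₄) ((l₅ - l) * c₅))) :
    HasDescartesSign (n + 1) (expSum l₁ l₂ l₃ l₄ l₅ c₁ u v c₃ c₄ c₅) := by
  have he (c : ℝ) (x : ℝ) :
      HasDerivAt (fun x : ℝ ↦ Real.exp (c * x)) (Real.exp (c * x) * c) x := by
    simpa using ((hasDerivAt_id x).const_mul c).exp
  have hu (x : ℝ) : HasDerivAt (fun x : ℝ ↦ u + v * x) v x := by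
    simpa using ((hasDerivAt_id x).const_mul v).const_add u
  refine HasDescartesSign.of_deriv_sub l (fun x ↦ ((((he l₁ x).const_mul c₁).add
    ((hu x).mul (he l₂ x))).add ((he l₃ x).const_mul c₃) |>.add
    ((he l₄ x).const_mul c₄)).add ((he l₅ x).const_mul c₅)) ?_
  convert h using 2 with x
  simp only [_root_.expSum]
  ring

/-- Killing l₁, l₂, l₃ leaves only the top exponential, with a nonnegative coefficient. The fourth
slot is a dummy: it repeats l₃ with coefficient 0. -/
lemma hasDescartesSign_expSum_four {l₁ l₂ l₃ l₅ c₁ u c₃ c₅ : ℝ} (h₁ : l₁ ≤ l₅) (h₂ : l₂ ≤ l₅)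
    (h₃ : l₃ ≤ l₅) (h₅ : 0 ≤ c₅) :
    HasDescartesSign 3 (expSum l₁ l₂ l₃ l₃ l₅ c₁ u 0 c₃ 0 c₅) := by
  refine .expSum l₁ (.expSum l₂ (.expSum l₃ (hasDescartesSign_zero fun x ↦ ?_)))
  have := mul_nonneg (sub_nonneg.2 h₃) (mul_nonneg (sub_nonneg.2 h₂)
    (mul_nonneg (sub_nonneg.2 h₁) h₅))
  simp only [expSum, sub_self]
  linear_combination mul_nonneg this (Real.exp_pos (l₅ * x)).le

/-- Only four operators are needed: l₂ twice for the affine coefficient, then l₁ and l₄. Two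
exponentials survive; the factor l₃ - l₄ ≤ 0 reverses the sign of c₃ ≤ 0, so both end up with
nonnegative coefficients. -/
lemma hasDescartesSign_expSum_five {l₁ l₂ l₃ l₄ l₅ c₁ u v c₃ c₄ c₅ : ℝ} (h₁₂ : l₁ ≤ l₂)
    (h₂₃ : l₂ ≤ l₃) (h₃₄ : l₃ ≤ l₄) (h₄₅ : l₄ ≤ l₅) (h₃ : c₃ ≤ 0) (h₅ : 0 ≤ c₅) :
    HasDescartesSign 4 (expSum l₁ l₂ l₃ l₄ l₅ c₁ u v c₃ c₄ c₅) := by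
  refine .expSum l₂ (.expSum l₂ (.expSum l₁ (.expSum l₄
    (hasDescartesSign_zero fun x ↦ ?_))))
  have e₃ : 0 ≤ (l₄ - l₃) * ((l₃ - l₁) * ((l₃ - l₂) * ((l₃ - l₂) * -c₃))) := by
    have := sub_nonneg.2 h₃₄
    have := sub_nonneg.2 h₂₃
    have := sub_nonneg.2 (h₁₂.trans h₂₃)
    have := neg_nonneg.2 h₃
    positivity
  have e₅ : 0 ≤ (l₅ - l₄) * ((l₅ - l₁) * ((l₅ - l₂) * ((l₅ - l₂) * c₅))) := by
    have := sub_nonneg.2 h₄₅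
    have := sub_nonneg.2 (h₂₃.trans (h₃₄.trans h₄₅))
    have := sub_nonneg.2 (h₁₂.trans (h₂₃.trans (h₃₄.trans h₄₅)))
    positivity
  have := add_nonneg (mul_nonneg e₃ (Real.exp_pos (l₃ * x)).le)
    (mul_nonneg e₅ (Real.exp_pos (l₅ * x)).le)
  simp only [expSum, sub_self]
  linear_combination this

/-! ### Comparison of normalised moments as functions of the exponent -/

/-- The absolute `q`-th moment at `(α, β, -(α + β))`, `0 ≤ β < α`, divided by `Γ (q + 1)`. -/
noncomputable def genericMoment (α β q : ℝ) : ℝ :=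
  (α ^ (q + 2) * (α + 2 * β) - β ^ (q + 2) * (2 * α + β) + (α - β) * (α + β) ^ (q + 2)) /
    ((α - β) * (2 * α + β) * (α + 2 * β))

lemma expSum_log {b₁ b₂ b₃ b₄ b₅ : ℝ} (h₁ : 0 < b₁) (h₂ : 0 < b₂) (h₃ : 0 < b₃) (h₄ : 0 < b₄)
    (h₅ : 0 < b₅) (c₁ u v c₃ c₄ c₅ x : ℝ) :
    expSum (Real.log b₁) (Real.log b₂) (Real.log b₃) (Real.log b₄) (Real.log b₅)
      c₁ u v c₃ c₄ c₅ x =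
    c₁ * b₁ ^ x + (u + v * x) * b₂ ^ x + c₃ * b₃ ^ x + c₄ * b₄ ^ x + c₅ * b₅ ^ x := by
  simp only [expSum, Real.rpow_def_of_pos h₁, Real.rpow_def_of_pos h₂, Real.rpow_def_of_pos h₃,
    Real.rpow_def_of_pos h₄, Real.rpow_def_of_pos h₅]

/-- Here τ ^ q is the normalised moment at `vecTwo`. Multiplied by d > 0, the difference is an
exponential sum in q with bases β, α, τ, α + β, the largest being α + β, and it has the three zeros
0, 2, 4. -/
lemma genericMoment_sub_mul_nonneg {α β τ : ℝ} (hβ : 0 < β) (hαβ : β < α) (hτ : 0 < τ)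
    (hτ2 : τ ^ 2 = 1 / 2) (h : α ^ 2 + α * β + β ^ 2 = 1 / 2) (q : ℝ) :
    0 ≤ (genericMoment α β q - τ ^ q) * (q * (q - 2) * (q - 4)) := by
  have hα : 0 < α := hβ.trans hαβ
  set d := (α - β) * (2 * α + β) * (α + 2 * β) with hd
  have hd0 : 0 < d := by have := sub_pos.2 hαβ; positivity
  have hle : τ ≤ α + β := by
    refine (sq_le_sq₀ (by positivity) (by positivity)).1 ?_
    nlinarith [mul_pos hα hβ]
  have hατ : α ≤ α + β := by linarith
  have hβα : β ≤ α + β := by linarith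
  have key := hasDescartesSign_expSum_four (c₁ := -β ^ 2 * (2 * α + β)) (u := α ^ 2 * (α + 2 * β))
    (c₃ := -d) (Real.log_le_log hβ hβα) (Real.log_le_log hα hατ) (Real.log_le_log hτ hle)
    (c₅ := (α - β) * (α + β) ^ 2) (mul_nonneg (sub_nonneg.2 hαβ.le) (by positivity))
  have hτ4 : τ ^ 4 = 1 / 4 := by rw [show τ ^ 4 = (τ ^ 2) ^ 2 by ring, hτ2]; norm_num
  have := key ![0, 2, 4] (by
      norm_num [Matrix.cons_val]
      exact Subsingleton.strictMono (α := Fin 1) _) (by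
      have h4 : (α ^ 2 + α * β + β ^ 2) ^ 2 = 1 / 4 := by rw [h]; norm_num
      intro i
      rw [expSum_log hβ hα hτ hτ (by positivity)]
      fin_cases i
      · simp [hd]
        ring
      · simp [hτ2, ← h, hd]
        ring
      · simp only [Fin.reduceFinMk, Matrix.cons_val, Real.rpow_ofNat, hτ4, ← h4, hd]
        ring) q
  rw [expSum_log hβ hα hτ hτ (by positivity)] at this
  simp only [Fin.prod_univ_three, Matrix.cons_val, sub_zero] at this
  have e : (genericMoment α β q - τ ^ q) = d⁻¹ * (-β ^ 2 * (2 * α + β) * β ^ q +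
      (α ^ 2 * (α + 2 * β) + 0 * q) * α ^ q + -d * τ ^ q + 0 * τ ^ q +
      (α - β) * (α + β) ^ 2 * (α + β) ^ q) := by
    rw [genericMoment, ← hd, Real.rpow_add hα, Real.rpow_add hβ, Real.rpow_add (by positivity)]
    simp only [Real.rpow_two]
    field_simp
    ring
  rw [e, mul_assoc]
  exact mul_nonneg (by positivity) this

/-- The term with s is the normalised moment at `vecOne`; its affine coefficient comes from the
double pole. The bases are ordered β ≤ s ≤ α ≤ α + β ≤ 2s, and there is a fourth zero at q = -2,
where both formulas vanish. -/
lemma sub_genericMoment_mul_nonneg {α β s : ℝ} (hβ : 0 < β) (hαβ : β < α) (hs : 0 < s)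
    (hs2 : s ^ 2 = 1 / 6) (h : α ^ 2 + α * β + β ^ 2 = 1 / 2) {q : ℝ} (hq : -2 < q) :
    0 ≤ (s ^ q * ((3 * q + 5 + 4 * 2 ^ q) / 9) - genericMoment α β q) *
      (q * (q - 2) * (q - 4)) := by
  have hα : 0 < α := hβ.trans hαβ
  set d := (α - β) * (2 * α + β) * (α + 2 * β) with hd
  have hd0 : 0 < d := by have := sub_pos.2 hαβ; positivity
  -- From β ≤ α, 3β² ≤ 1/2 ≤ 3α². Moreover 3αβ ≤ 1/2, so (α + β)² = 1/2 + αβ ≤ 2/3 = (2s)².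
  have h12 : β ≤ s := by
    refine (sq_le_sq₀ (by positivity) (by positivity)).1 ?_
    nlinarith [mul_pos hα hβ]
  have h23 : s ≤ α := by
    refine (sq_le_sq₀ (by positivity) (by positivity)).1 ?_
    nlinarith [mul_pos hα hβ]
  have h34 : α ≤ α + β := by linarith
  have h45 : α + β ≤ 2 * s := by
    refine (sq_le_sq₀ (by positivity) (by positivity)).1 ?_
    nlinarith [sq_nonneg (α - β)]
  have key := hasDescartesSign_expSum_five (c₁ := β ^ 2 * (2 * α + β)) (u := 5 / 9 * d)
    (v := 3 / 9 * d) (c₃ := -α ^ 2 * (α + 2 * β)) (c₄ := -(α - β) * (α + β) ^ 2)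
    (c₅ := 4 / 9 * d)
    (Real.log_le_log hβ h12) (Real.log_le_log hs h23) (Real.log_le_log hα h34)
    (Real.log_le_log (by positivity) h45)
    (by have : 0 ≤ α ^ 2 * (α + 2 * β) := by positivity
        linarith) (by positivity)
  have hs4 : s ^ 4 = 1 / 36 := by rw [show s ^ 4 = (s ^ 2) ^ 2 by ring, hs2]; norm_num
  have := key ![-2, 0, 2, 4] (by
      norm_num [Matrix.cons_val]
      exact Subsingleton.strictMono (α := Fin 1) _) (by
      have h4 : (α ^ 2 + α * β + β ^ 2) ^ 2 = 1 / 4 := by rw [h]; norm_num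
      intro i
      rw [expSum_log hβ hs hα (by positivity) (by positivity)]
      fin_cases i
      · simp only [Fin.zero_eta, Matrix.cons_val_zero,
          Real.rpow_neg_ofNat, zpow_neg, zpow_ofNat, mul_pow, hs2]
        field_simp
        ring
      · simp [hd]
        ring
      · simp only [Fin.reduceFinMk, Matrix.cons_val, Real.rpow_ofNat, mul_pow, hs2, hd]
        linear_combination (2 * α ^ 3 + 3 * α ^ 2 * β - 3 * α * β ^ 2 - 2 * β ^ 3) * (-h)
      · simp only [Fin.reduceFinMk, Matrix.cons_val, Real.rpow_ofNat, mul_pow, hs4, hd]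
        linear_combination (2 * α ^ 3 + 3 * α ^ 2 * β - 3 * α * β ^ 2 - 2 * β ^ 3) * (-h4)) q
  rw [expSum_log hβ hs hα (by positivity) (by positivity)] at this
  simp only [Fin.prod_univ_four, Matrix.cons_val, sub_zero, sub_neg_eq_add] at this
  have e : (s ^ q * ((3 * q + 5 + 4 * 2 ^ q) / 9) - genericMoment α β q) =
      d⁻¹ * (β ^ 2 * (2 * α + β) * β ^ q + (5 / 9 * d + 3 / 9 * d * q) * s ^ q +
      -α ^ 2 * (α + 2 * β) * α ^ q + -(α - β) * (α + β) ^ 2 * (α + β) ^ q +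
      4 / 9 * d * (2 * s) ^ q) := by
    rw [genericMoment, ← hd, Real.rpow_add hα, Real.rpow_add hβ, Real.rpow_add (by positivity),
      Real.mul_rpow (by norm_num) hs.le]
    simp only [Real.rpow_two]
    field_simp
    ring
  rw [e, mul_assoc]
  -- The zero at -2 contributes the factor q + 2, positive in the present range, which is divided
  -- out.
  refine mul_nonneg (by positivity) (nonneg_of_mul_nonneg_left ?_ (show 0 < q + 2 by linarith))
  linarith

/-! ### Moments and characteristic functions of Gamma laws -/

lemma measurable_gammaPDF (k r : ℝ) : Measurable (gammaPDF k r) :=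
  (measurable_gammaPDFReal k r).ennreal_ofReal

lemma gammaPDF_toReal_of_pos {k x : ℝ} (hk : 0 < k) (hx : 0 < x) :
    (gammaPDF k 1 x).toReal = (Real.Gamma k)⁻¹ * (x ^ (k - 1) * Real.exp (-x)) := by
  rw [gammaPDF, ENNReal.toReal_ofReal (gammaPDFReal_nonneg hk one_pos x), gammaPDFReal,
    if_pos hx.le]
  simp
  ring

lemma integral_gammaMeasure {E : Type*} [NormedAddCommGroup E] [NormedSpace ℝ E] {k : ℝ}
    (hk : 0 < k) (g : ℝ → E) :
    ∫ x, g x ∂gammaMeasure k 1 =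
      (Real.Gamma k)⁻¹ • ∫ x in Set.Ioi 0, (x ^ (k - 1) * Real.exp (-x)) • g x := by
  rw [gammaMeasure, integral_withDensity_eq_integral_toReal_smul
    (measurable_gammaPDF k 1) (by simp [gammaPDF]),
    ← integral_smul, ← setIntegral_eq_integral_of_forall_compl_eq_zero (s := Set.Ici 0),
    integral_Ici_eq_integral_Ioi]
  · refine setIntegral_congr_fun measurableSet_Ioi fun x hx ↦ ?_
    rw [gammaPDF_toReal_of_pos hk hx, smul_smul]
  · intro x hx
    rw [gammaPDF_of_neg (by simpa using hx)]
    simp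

lemma integrable_gammaMeasure_iff {E : Type*} [NormedAddCommGroup E] [NormedSpace ℝ E] {k : ℝ}
    (hk : 0 < k) (g : ℝ → E) :
    Integrable g (gammaMeasure k 1) ↔
      IntegrableOn (fun x ↦ (x ^ (k - 1) * Real.exp (-x)) • g x) (Set.Ioi 0) := by
  rw [gammaMeasure, integrable_withDensity_iff_integrable_smul'
    (measurable_gammaPDF k 1) (by simp [gammaPDF]),
    ← integrableOn_iff_integrable_of_support_subset (s := Set.Ici 0),
    integrableOn_Ici_iff_integrableOn_Ioi]
  · rw [integrableOn_congr_fun (g := fun x ↦ (Real.Gamma k)⁻¹ •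
      ((x ^ (k - 1) * Real.exp (-x)) • g x)) _ measurableSet_Ioi]
    · exact integrable_smul_iff (inv_ne_zero (Real.Gamma_pos_of_pos hk).ne') _
    · intro x hx
      simp only
      rw [gammaPDF_toReal_of_pos hk hx, smul_smul]
  · intro x hx
    by_contra h
    exact hx (by simp only; rw [gammaPDF_of_neg (by simpa using h)]; simp)

lemma gamma_integrand_eq (k q c : ℝ) {x : ℝ} (hx : 0 < x) :
    (x ^ (k - 1) * Real.exp (-x)) • |c * x| ^ q =
      |c| ^ q * (Real.exp (-x) * x ^ (q + k - 1)) := by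
  rw [abs_mul, Real.mul_rpow (abs_nonneg _) (abs_nonneg _), abs_of_pos hx, smul_eq_mul,
    show q + k - 1 = (k - 1) + q by ring, Real.rpow_add hx]
  ring

lemma integrable_abs_mul_rpow_gammaMeasure {k q : ℝ} (hk : 0 < k) (hq : 0 < q + k) (c : ℝ) :
    Integrable (fun x ↦ |c * x| ^ q) (gammaMeasure k 1) := by
  rw [integrable_gammaMeasure_iff hk, integrableOn_congr_fun
    (fun x hx ↦ gamma_integrand_eq k q c (Set.mem_Ioi.1 hx)) measurableSet_Ioi]
  exact (Real.GammaIntegral_convergent hq).const_mul _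

lemma integral_abs_mul_rpow_gammaMeasure {k q : ℝ} (hk : 0 < k) (hq : 0 < q + k) (c : ℝ) :
    ∫ x, |c * x| ^ q ∂gammaMeasure k 1 = |c| ^ q * (Real.Gamma (q + k) / Real.Gamma k) := by
  rw [integral_gammaMeasure hk, setIntegral_congr_fun measurableSet_Ioi
    (fun x hx ↦ gamma_integrand_eq k q c hx), integral_const_mul, ← Real.Gamma_eq_integral hq,
    smul_eq_mul]
  ring

lemma one_sub_mul_I_ne_zero (t : ℝ) : (1 - t * Complex.I : ℂ) ≠ 0 := fun h ↦ by
  simpa using congrArg Complex.re h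

lemma charFun_gammaMeasure_one (t : ℝ) :
    charFun (gammaMeasure 1 1) t = (1 - t * Complex.I)⁻¹ := by
  rw [charFun_apply_real, integral_gammaMeasure one_pos]
  have h : ∀ x ∈ Set.Ioi (0 : ℝ), (x ^ ((1 : ℝ) - 1) * Real.exp (-x)) •
      Complex.exp (t * x * Complex.I) = Complex.exp ((t * Complex.I - 1) * x) := by
    intro x _
    simp only [sub_self, Real.rpow_zero, one_mul, Complex.real_smul, Complex.ofReal_exp]
    rw [← Complex.exp_add]
    push_cast
    ring_nf
  rw [setIntegral_congr_fun measurableSet_Ioi h, integral_exp_mul_complex_Ioi (by simp)]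
  have h1 := one_sub_mul_I_ne_zero t
  have h2 : (t * Complex.I - 1 : ℂ) ≠ 0 := by
    rw [← neg_sub]; exact neg_ne_zero.2 h1
  simp
  rw [neg_div, ← div_neg, neg_sub, one_div]

lemma charFun_gammaMeasure_two (t : ℝ) :
    charFun (gammaMeasure 2 1) t = ((1 - t * Complex.I) ^ 2)⁻¹ := by
  rw [charFun_apply_real, integral_gammaMeasure two_pos]
  set z : ℂ := 1 - t * Complex.I with hz
  have hz0 : z ≠ 0 := one_sub_mul_I_ne_zero t
  have h : ∀ x ∈ Set.Ioi (0 : ℝ), (x ^ ((2 : ℝ) - 1) * Real.exp (-x)) •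
      Complex.exp (t * x * Complex.I) = x * Complex.exp (-z * x) := by
    intro x _
    rw [show (2 : ℝ) - 1 = 1 by norm_num, Real.rpow_one, Complex.real_smul, Complex.ofReal_mul,
      Complex.ofReal_exp, mul_assoc, ← Complex.exp_add, hz]
    push_cast
    ring_nf
  have hnorm (x : ℝ) : ‖Complex.exp (-z * x)‖ = Real.exp (-x) := by
    simp [Complex.norm_exp, hz]
  have hd (x : ℝ) : HasDerivAt (fun x : ℝ ↦ -((x : ℂ) / z + 1 / z ^ 2) * Complex.exp (-z * x))
      (x * Complex.exp (-z * x)) x := by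
    have h1 : HasDerivAt (fun x : ℝ ↦ Complex.exp (-z * x)) (Complex.exp (-z * x) * -z) x := by
      simpa using ((Complex.ofRealCLM.hasDerivAt (x := x)).const_mul (-z)).cexp
    have h2 : HasDerivAt (fun x : ℝ ↦ -((x : ℂ) / z + 1 / z ^ 2)) (-(1 / z)) x := by
      exact (((Complex.ofRealCLM.hasDerivAt (x := x)).div_const z).add_const (1 / z ^ 2)).neg
    refine (h2.mul h1).congr_deriv ?_
    field_simp
    ring
  have hlim (n : ℕ) : Filter.Tendsto (fun x : ℝ ↦ (x : ℂ) ^ n * Complex.exp (-z * x))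
      Filter.atTop (nhds 0) := by
    rw [tendsto_zero_iff_norm_tendsto_zero]
    refine (Real.tendsto_pow_mul_exp_neg_atTop_nhds_zero n).congr' ?_
    filter_upwards [Filter.eventually_ge_atTop 0] with x hx
    rw [norm_mul, hnorm, norm_pow, Complex.norm_real, Real.norm_of_nonneg hx]
  have hint : IntegrableOn (fun x : ℝ ↦ (x : ℂ) * Complex.exp (-z * x)) (Set.Ioi 0) := by
    refine (Real.GammaIntegral_convergent two_pos).mono'
      (by fun_prop) ((ae_restrict_iff' measurableSet_Ioi).2 (.of_forall fun x hx ↦ ?_))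
    rw [norm_mul, hnorm, Complex.norm_real, Real.norm_of_nonneg (le_of_lt hx),
      show (2 : ℝ) - 1 = 1 by norm_num, Real.rpow_one, mul_comm]
  have hl : Filter.Tendsto (fun x : ℝ ↦ -((x : ℂ) / z + 1 / z ^ 2) * Complex.exp (-z * x))
      Filter.atTop (nhds 0) := by
    have := ((hlim 1).const_mul (-(1 / z))).add ((hlim 0).const_mul (-(1 / z ^ 2)))
    simp only [mul_zero, add_zero] at this
    refine this.congr fun x ↦ ?_
    ring
  rw [setIntegral_congr_fun measurableSet_Ioi h,
    integral_Ioi_of_hasDerivAt_of_tendsto' (fun x _ ↦ hd x) hint hl]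
  simp

/-- The characteristic function of `∑ i, a i * X i` for independent standard exponential `X i`. -/
lemma charFun_map_sum_mul {Ω : Type*} [MeasurableSpace Ω] {P : Measure Ω}
    {X : Fin 3 → Ω → ℝ} (hindep : iIndepFun X P)
    (hlaw : ∀ i, HasLaw (X i) (expMeasure 1) P) (a : Fin 3 → ℝ) (t : ℝ) :
    charFun (P.map fun ω ↦ ∑ i, a i * X i ω) t = ∏ i, (1 - (a i * t : ℝ) * Complex.I)⁻¹ := by
  have h : iIndepFun (fun i ω ↦ a i * X i ω) P :=
    hindep.comp (fun i x ↦ a i * x) fun i ↦ measurable_const_mul _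
  rw [h.charFun_map_fun_sum_eq_prod fun i ↦ (hlaw i).aemeasurable.const_mul _,
    Finset.prod_apply]
  refine Finset.prod_congr rfl fun i _ ↦ ?_
  rw [charFun_map_mul_comp (hlaw i).aemeasurable, (hlaw i).map_eq, expMeasure,
    charFun_gammaMeasure_one]

/-! ### Reduction by permutations and sign -/

lemma absPow_neg {Ω : Type*} (X : Fin 3 → Ω → ℝ) (q : ℝ) (a : Fin 3 → ℝ) :
    absPow X q (-a) = absPow X q a := by
  ext ω
  simp only [absPow, Pi.neg_apply, neg_mul, Finset.sum_neg_distrib, abs_neg]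

section Law

variable {Ω : Type*} [MeasurableSpace Ω] {P : Measure Ω} {X : Fin 3 → Ω → ℝ}

lemma aemeasurable_sum_mul (hlaw : ∀ i, HasLaw (X i) (expMeasure 1) P) (a : Fin 3 → ℝ) :
    AEMeasurable (fun ω ↦ ∑ i, a i * X i ω) P :=
  Finset.aemeasurable_fun_sum _ fun i _ ↦ (hlaw i).aemeasurable.const_mul _

lemma measurable_abs_rpow (q : ℝ) : Measurable fun x : ℝ ↦ |x| ^ q :=
  (measurable_id.abs).pow_const q

lemma absMoment_eq_integral_map (hlaw : ∀ i, HasLaw (X i) (expMeasure 1) P) (q : ℝ)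
    (a : Fin 3 → ℝ) :
    absMoment P X q a = ∫ x, |x| ^ q ∂P.map fun ω ↦ ∑ i, a i * X i ω := by
  rw [integral_map (aemeasurable_sum_mul hlaw a) (measurable_abs_rpow q).aestronglyMeasurable]
  rfl

lemma integrable_absPow_iff (hlaw : ∀ i, HasLaw (X i) (expMeasure 1) P) (q : ℝ)
    (a : Fin 3 → ℝ) :
    Integrable (absPow X q a) P ↔
      Integrable (fun x ↦ |x| ^ q) (P.map fun ω ↦ ∑ i, a i * X i ω) := by
  rw [integrable_map_measure (measurable_abs_rpow q).aestronglyMeasurable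
    (aemeasurable_sum_mul hlaw a)]
  rfl

/-- The characteristic function is a product over the coordinates of a, hence symmetric in them. -/
lemma map_sum_mul_comp_perm [IsProbabilityMeasure P] (hindep : iIndepFun X P)
    (hlaw : ∀ i, HasLaw (X i) (expMeasure 1) P) (a : Fin 3 → ℝ) (σ : Equiv.Perm (Fin 3)) :
    (P.map fun ω ↦ ∑ i, (a ∘ σ) i * X i ω) = P.map fun ω ↦ ∑ i, a i * X i ω := by
  refine Measure.ext_of_charFun (funext fun t ↦ ?_)
  rw [charFun_map_sum_mul hindep hlaw, charFun_map_sum_mul hindep hlaw]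
  exact Equiv.prod_comp σ fun i ↦ (1 - (a i * t : ℝ) * Complex.I)⁻¹

/-- The vector `(α, β, -(α + β))`. -/
def centredVec (α β : ℝ) : Fin 3 → ℝ := ![α, β, -(α + β)]

lemma exists_centredVec_of_mem {a : Fin 3 → ℝ} (ha : a ∈ centredSphere) :
    ∃ (σ : Equiv.Perm (Fin 3)) (α β : ℝ), 0 ≤ β ∧ β ≤ α ∧ α ^ 2 + α * β + β ^ 2 = 1 / 2 ∧
      (a ∘ σ = centredVec α β ∨ a ∘ σ = -centredVec α β) := by
  set τ := Tuple.sort a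
  have hmono : Monotone (a ∘ τ) := Tuple.monotone_sort a
  have h01 : a (τ 0) ≤ a (τ 1) := hmono (by decide)
  have h12 : a (τ 1) ≤ a (τ 2) := hmono (by decide)
  have hs : a (τ 0) + a (τ 1) + a (τ 2) = 0 := by
    rw [← ha.1, ← Equiv.sum_comp τ, Fin.sum_univ_three]
  have hq : a (τ 0) ^ 2 + a (τ 1) ^ 2 + a (τ 2) ^ 2 = 1 := by
    rw [← ha.2, ← Equiv.sum_comp τ, Fin.sum_univ_three]
  -- The sign of the middle coordinate decides: if it is nonnegative, the increasing order is
  -- reversed; otherwise the vector is negated.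
  rcases le_total 0 (a (τ 1)) with h | h
  · refine ⟨(Equiv.swap 0 2).trans τ, a (τ 2), a (τ 1), h, h12, ?_, .inl ?_⟩
    · have : a (τ 0) = -(a (τ 1) + a (τ 2)) := by linarith
      rw [this] at hq
      linarith
    · ext i
      fin_cases i
      · simp [centredVec]
      · simp [centredVec, Equiv.swap_apply_of_ne_of_ne]
      · simp [centredVec]
        linarith
  · refine ⟨τ, -a (τ 0), -a (τ 1), by linarith, by linarith, ?_, .inr ?_⟩
    · have : a (τ 2) = -(a (τ 0) + a (τ 1)) := by linarith
      rw [this] at hq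
      linarith
    · ext i
      fin_cases i
      · simp [centredVec]
      · simp [centredVec]
      · simp [centredVec]
        linarith

lemma exists_absMoment_eq_centredVec [IsProbabilityMeasure P] (hindep : iIndepFun X P)
    (hlaw : ∀ i, HasLaw (X i) (expMeasure 1) P) {a : Fin 3 → ℝ} (ha : a ∈ centredSphere) :
    ∃ α β : ℝ, 0 ≤ β ∧ β ≤ α ∧ α ^ 2 + α * β + β ^ 2 = 1 / 2 ∧ ∀ q,
      (Integrable (absPow X q (centredVec α β)) P → Integrable (absPow X q a) P) ∧
      absMoment P X q a = absMoment P X q (centredVec α β) := by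
  obtain ⟨σ, α, β, h0, h1, h2, h⟩ := exists_centredVec_of_mem ha
  refine ⟨α, β, h0, h1, h2, fun q ↦ ?_⟩
  have key : absPow X q (a ∘ σ) = absPow X q (centredVec α β) := by
    rcases h with h | h
    · rw [h]
    · rw [h, absPow_neg]
  constructor
  · rw [← key, integrable_absPow_iff hlaw, integrable_absPow_iff hlaw,
      map_sum_mul_comp_perm hindep hlaw]
    exact id
  · have : absMoment P X q (a ∘ σ) = absMoment P X q (centredVec α β) := by
      rw [absMoment, key, absMoment]
    rw [← this, absMoment_eq_integral_map hlaw, absMoment_eq_integral_map hlaw,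
      map_sum_mul_comp_perm hindep hlaw]

/-! ### Laws as mixtures of scaled Gamma laws, and the resulting moments -/

/-- The law of `c Z` for `Z` of gamma distribution with shape `k`. -/
noncomputable def scaledGamma (k c : ℝ) : Measure ℝ := (gammaMeasure k 1).map (c * ·)

lemma isProbabilityMeasure_scaledGamma {k : ℝ} (hk : 0 < k) (c : ℝ) :
    IsProbabilityMeasure (scaledGamma k c) := by
  have := isProbabilityMeasure_gammaMeasure hk one_pos
  exact Measure.isProbabilityMeasure_map (by fun_prop)

lemma integrable_scaledGamma {k q : ℝ} (hk : 0 < k) (hq : 0 < q + k) (c : ℝ) :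
    Integrable (fun x ↦ |x| ^ q) (scaledGamma k c) := by
  rw [scaledGamma, integrable_map_measure (measurable_abs_rpow q).aestronglyMeasurable
    (by fun_prop)]
  exact integrable_abs_mul_rpow_gammaMeasure hk hq c

lemma integral_scaledGamma {k q : ℝ} (hk : 0 < k) (hq : 0 < q + k) (c : ℝ) :
    ∫ x, |x| ^ q ∂scaledGamma k c = |c| ^ q * (Real.Gamma (q + k) / Real.Gamma k) := by
  rw [scaledGamma, integral_map (by fun_prop) (measurable_abs_rpow q).aestronglyMeasurable]
  exact integral_abs_mul_rpow_gammaMeasure hk hq c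

lemma charFun_scaledGamma_one (c t : ℝ) :
    charFun (scaledGamma 1 c) t = (1 - (c * t : ℝ) * Complex.I)⁻¹ := by
  rw [scaledGamma, charFun_map_mul, charFun_gammaMeasure_one]

lemma charFun_scaledGamma_two (c t : ℝ) :
    charFun (scaledGamma 2 c) t = ((1 - (c * t : ℝ) * Complex.I) ^ 2)⁻¹ := by
  rw [scaledGamma, charFun_map_mul, charFun_gammaMeasure_two]

lemma charFun_add_measure {μ ν : Measure ℝ} [IsFiniteMeasure μ] [IsFiniteMeasure ν] (t : ℝ) :
    charFun (μ + ν) t = charFun μ t + charFun ν t := by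
  simp only [charFun_eq_integral_innerProbChar]
  exact integral_add_measure (BoundedContinuousFunction.integrable _ _)
    (BoundedContinuousFunction.integrable _ _)

lemma charFun_smul_measure (c : NNReal) (μ : Measure ℝ) (t : ℝ) :
    charFun (c • μ) t = (c : ℝ) * charFun μ t := by
  rw [charFun_apply_real, integral_smul_nnreal_measure, charFun_apply_real]
  rfl

/-- Partial fractions of the characteristic function with simple poles. The coefficient of the β
term is nonpositive, so that term is moved to the left to keep both sides positive measures. -/
lemma map_sum_centredVec_add [IsProbabilityMeasure P] (hindep : iIndepFun X P)
    (hlaw : ∀ i, HasLaw (X i) (expMeasure 1) P) {α β : ℝ} (hβ : 0 ≤ β) (hαβ : β < α) :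
    (P.map fun ω ↦ ∑ i, centredVec α β i * X i ω) +
      (β ^ 2 / ((α - β) * (α + 2 * β))).toNNReal • scaledGamma 1 β =
    (α ^ 2 / ((α - β) * (2 * α + β))).toNNReal • scaledGamma 1 α +
      ((α + β) ^ 2 / ((2 * α + β) * (α + 2 * β))).toNNReal • scaledGamma 1 (-(α + β)) := by
  have hα : 0 < α := hβ.trans_lt hαβ
  have hd : 0 < α - β := sub_pos.2 hαβ
  have (c : ℝ) := isProbabilityMeasure_scaledGamma one_pos c
  refine Measure.ext_of_charFun (funext fun t ↦ ?_)
  rw [charFun_add_measure, charFun_add_measure, charFun_smul_measure, charFun_smul_measure,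
    charFun_smul_measure, Real.coe_toNNReal _ (by positivity), Real.coe_toNNReal _ (by positivity),
    Real.coe_toNNReal _ (by positivity), charFun_map_sum_mul hindep hlaw,
    charFun_scaledGamma_one, charFun_scaledGamma_one, charFun_scaledGamma_one]
  have n1 := one_sub_mul_I_ne_zero (α * t)
  have n2 := one_sub_mul_I_ne_zero (β * t)
  have n3 := one_sub_mul_I_ne_zero (-(α + β) * t)
  have m1 : (α - β : ℂ) ≠ 0 := by exact_mod_cast hd.ne'
  have m2 : (2 * α + β : ℂ) ≠ 0 := by exact_mod_cast (by positivity : 2 * α + β ≠ 0)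
  have m3 : (α + 2 * β : ℂ) ≠ 0 := by exact_mod_cast (by positivity : α + 2 * β ≠ 0)
  simp only [centredVec, Fin.prod_univ_three, Matrix.cons_val]
  push_cast at n1 n2 n3 ⊢
  generalize (t : ℂ) = t, Complex.I = I, (α : ℂ) = α, (β : ℂ) = β at *
  -- The linear factors become atoms with known nonvanishing, so that denominators clear before the
  -- factors are expanded again.
  generalize hx : 1 - α * t * I = x, hy : 1 - β * t * I = y, hz : 1 - -(α + β) * t * I = z,
    hp : α - β = p, hr : 2 * α + β = r, hw : α + 2 * β = w at *
  field_simp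
  rw [← hx, ← hy, ← hz, ← hp, ← hr, ← hw]
  ring

/-- When β = α the two poles merge, and the double pole is the characteristic function of a scaled
Gamma(2) law. -/
lemma map_sum_centredVec_self [IsProbabilityMeasure P] (hindep : iIndepFun X P)
    (hlaw : ∀ i, HasLaw (X i) (expMeasure 1) P) (s : ℝ) :
    (P.map fun ω ↦ ∑ i, centredVec s s i * X i ω) =
      (2 / 9 : NNReal) • scaledGamma 1 s + (1 / 3 : NNReal) • scaledGamma 2 s +
      (4 / 9 : NNReal) • scaledGamma 1 (-(s + s)) := by
  have (c : ℝ) := isProbabilityMeasure_scaledGamma one_pos c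
  have (c : ℝ) := isProbabilityMeasure_scaledGamma two_pos c
  refine Measure.ext_of_charFun (funext fun t ↦ ?_)
  rw [charFun_add_measure, charFun_add_measure, charFun_smul_measure, charFun_smul_measure,
    charFun_smul_measure, charFun_map_sum_mul hindep hlaw,
    charFun_scaledGamma_one, charFun_scaledGamma_one, charFun_scaledGamma_two]
  have n1 := one_sub_mul_I_ne_zero (s * t)
  have n3 := one_sub_mul_I_ne_zero (-(s + s) * t)
  simp only [centredVec, Fin.prod_univ_three, Matrix.cons_val]
  push_cast at n1 n3 ⊢
  generalize (t : ℂ) = t, Complex.I = I, (s : ℂ) = s at *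
  generalize hx : 1 - s * t * I = x, hz : 1 - -(s + s) * t * I = z at *
  field_simp
  rw [← hx, ← hz]
  ring

lemma integrable_and_absMoment_centredVec [IsProbabilityMeasure P] (hindep : iIndepFun X P)
    (hlaw : ∀ i, HasLaw (X i) (expMeasure 1) P) {α β q : ℝ} (hβ : 0 ≤ β) (hαβ : β < α)
    (hq : -1 < q) :
    Integrable (absPow X q (centredVec α β)) P ∧
      absMoment P X q (centredVec α β) = Real.Gamma (q + 1) * genericMoment α β q := by
  have hα : 0 < α := hβ.trans_lt hαβ
  have hd : 0 < α - β := sub_pos.2 hαβ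
  have hq1 : 0 < q + 1 := by linarith
  have hi (c : ℝ) := integrable_scaledGamma one_pos hq1 c
  have hir (c : NNReal) (d : ℝ) : Integrable (fun x ↦ |x| ^ q) (c • scaledGamma 1 d) :=
    (hi d).smul_measure_nnreal
  have e := map_sum_centredVec_add hindep hlaw hβ hαβ
  set ν := P.map fun ω ↦ ∑ i, centredVec α β i * X i ω with hν
  have hint : Integrable (fun x ↦ |x| ^ q) ν := by
    -- The law is a summand of a positive measure that equals a combination of exponential laws, so
    -- it inherits integrability.
    have h : Integrable (fun x ↦ |x| ^ q)
        (ν + (β ^ 2 / ((α - β) * (α + 2 * β))).toNNReal • scaledGamma 1 β) := by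
      rw [e]
      exact (hir _ _).add_measure (hir _ _)
    exact h.left_of_add_measure
  refine ⟨(integrable_absPow_iff hlaw q _).2 hint, ?_⟩
  rw [absMoment_eq_integral_map hlaw, ← hν]
  have h := congrArg (fun μ ↦ ∫ x, |x| ^ q ∂μ) e
  rw [integral_add_measure hint (hir _ _), integral_add_measure (hir _ _) (hir _ _),
    integral_smul_nnreal_measure, integral_smul_nnreal_measure, integral_smul_nnreal_measure,
    integral_scaledGamma one_pos hq1, integral_scaledGamma one_pos hq1,
    integral_scaledGamma one_pos hq1] at h
  simp only [NNReal.smul_def, smul_eq_mul, abs_neg] at h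
  rw [Real.coe_toNNReal _ (by positivity), Real.coe_toNNReal _ (by positivity),
    Real.coe_toNNReal _ (by positivity), abs_of_nonneg hβ, abs_of_pos hα,
    abs_of_pos (by positivity : 0 < α + β), Real.Gamma_one, div_one] at h
  -- Since β may be 0, splitting the power of β relies on q + 2 ≠ 0 instead of β > 0.
  rw [genericMoment, Real.rpow_add' hβ (by linarith), Real.rpow_add hα,
    Real.rpow_add (by positivity), eq_sub_of_add_eq h]
  simp only [Real.rpow_two]
  field_simp
  ring

lemma integrable_and_absMoment_centredVec_self [IsProbabilityMeasure P] (hindep : iIndepFun X P)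
    (hlaw : ∀ i, HasLaw (X i) (expMeasure 1) P) {s q : ℝ} (hs : 0 < s) (hq : -1 < q) :
    Integrable (absPow X q (centredVec s s)) P ∧
      absMoment P X q (centredVec s s) =
        Real.Gamma (q + 1) * (s ^ q * ((3 * q + 5 + 4 * 2 ^ q) / 9)) := by
  have hq1 : 0 < q + 1 := by linarith
  have hq2 : 0 < q + 2 := by linarith
  have hir (c : NNReal) (d : ℝ) : Integrable (fun x ↦ |x| ^ q) (c • scaledGamma 1 d) :=
    (integrable_scaledGamma one_pos hq1 d).smul_measure_nnreal
  have hir2 (c : NNReal) (d : ℝ) : Integrable (fun x ↦ |x| ^ q) (c • scaledGamma 2 d) :=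
    (integrable_scaledGamma two_pos hq2 d).smul_measure_nnreal
  have e := map_sum_centredVec_self hindep hlaw s
  rw [integrable_absPow_iff hlaw, absMoment_eq_integral_map hlaw, e]
  refine ⟨((hir _ _).add_measure (hir2 _ _)).add_measure (hir _ _), ?_⟩
  rw [integral_add_measure ((hir _ _).add_measure (hir2 _ _)) (hir _ _),
    integral_add_measure (hir _ _) (hir2 _ _),
    integral_smul_nnreal_measure, integral_smul_nnreal_measure, integral_smul_nnreal_measure,
    integral_scaledGamma one_pos hq1, integral_scaledGamma one_pos hq1,
    integral_scaledGamma two_pos hq2]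
  simp only [NNReal.smul_def, smul_eq_mul, abs_neg]
  rw [abs_of_pos hs, abs_of_pos (by positivity : 0 < s + s), Real.Gamma_one, Real.Gamma_two,
    show q + 2 = (q + 1) + 1 by ring, Real.Gamma_add_one hq1.ne', ← two_mul,
    Real.mul_rpow two_pos.le hs.le]
  push_cast
  ring

end Law

/-! ### The two extremal vectors and the exponents 2 and 4 -/

lemma vecOne_eq_centredVec : vecOne = centredVec (1 / √6) (1 / √6) := by
  ext i
  fin_cases i
  · simp [vecOne, centredVec]
  · simp [vecOne, centredVec]
  · simp [vecOne, centredVec]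
    ring

lemma vecTwo_comp_swap : vecTwo ∘ Equiv.swap 1 2 = centredVec (1 / √2) 0 := by
  ext i
  fin_cases i
  · simp [vecTwo, centredVec, Equiv.swap_apply_of_ne_of_ne]
  · simp [vecTwo, centredVec]
  · simp [vecTwo, centredVec]
    ring

lemma one_div_sqrt_sq {x : ℝ} (hx : 0 ≤ x) : (1 / √x) ^ 2 = 1 / x := by
  rw [div_pow, Real.sq_sqrt hx, one_pow]

lemma vecOne_mem : vecOne ∈ centredSphere := by
  rw [vecOne_eq_centredVec]
  have h := one_div_sqrt_sq (show (0 : ℝ) ≤ 6 by norm_num)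
  constructor
  · simp [centredVec, Fin.sum_univ_three]
  · simp only [centredVec, Fin.sum_univ_three, Matrix.cons_val]
    linear_combination 6 * h

lemma vecTwo_mem : vecTwo ∈ centredSphere := by
  have h := one_div_sqrt_sq (show (0 : ℝ) ≤ 2 by norm_num)
  constructor
  · simp only [vecTwo, Fin.sum_univ_three, Matrix.cons_val]
    ring
  · simp only [vecTwo, Fin.sum_univ_three, Matrix.cons_val]
    linear_combination 2 * h

lemma genericMoment_zero_right {α q : ℝ} (hα : 0 < α) (hq : -2 < q) :
    genericMoment α 0 q = α ^ q := by
  rw [genericMoment, Real.zero_rpow (by linarith)]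
  simp only [add_zero, sub_zero, mul_zero, Real.rpow_add hα, Real.rpow_two]
  field_simp
  ring

lemma genericMoment_two {α β : ℝ} (hβ : 0 ≤ β) (hαβ : β < α) :
    genericMoment α β 2 = α ^ 2 + α * β + β ^ 2 := by
  have := sub_pos.2 hαβ
  have : 0 < α := by linarith
  rw [genericMoment, show (2 : ℝ) + 2 = (4 : ℕ) by norm_num]
  simp only [Real.rpow_natCast]
  rw [div_eq_iff (by positivity)]
  ring

lemma genericMoment_four {α β : ℝ} (hβ : 0 ≤ β) (hαβ : β < α) :
    genericMoment α β 4 = (α ^ 2 + α * β + β ^ 2) ^ 2 := by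
  have := sub_pos.2 hαβ
  have : 0 < α := by linarith
  rw [genericMoment, show (4 : ℝ) + 2 = (6 : ℕ) by norm_num]
  simp only [Real.rpow_natCast]
  rw [div_eq_iff (by positivity)]
  ring

/-! ### Sign of the moment differences and extremality -/

section Extremal

variable {Ω : Type*} [MeasurableSpace Ω] {P : Measure Ω} [IsProbabilityMeasure P]
  {X : Fin 3 → Ω → ℝ}

lemma absMoment_vecTwo (hindep : iIndepFun X P)
    (hlaw : ∀ i, HasLaw (X i) (expMeasure 1) P) {q : ℝ} (hq : -1 < q) :
    absMoment P X q vecTwo = Real.Gamma (q + 1) * (1 / √2) ^ q := by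
  rw [absMoment_eq_integral_map hlaw, ← map_sum_mul_comp_perm hindep hlaw _ (Equiv.swap 1 2),
    ← absMoment_eq_integral_map hlaw, vecTwo_comp_swap,
    (integrable_and_absMoment_centredVec hindep hlaw le_rfl (by positivity) hq).2,
    genericMoment_zero_right (by positivity) (by linarith)]

lemma absMoment_vecOne (hindep : iIndepFun X P)
    (hlaw : ∀ i, HasLaw (X i) (expMeasure 1) P) {q : ℝ} (hq : -1 < q) :
    absMoment P X q vecOne =
      Real.Gamma (q + 1) * ((1 / √6) ^ q * ((3 * q + 5 + 4 * 2 ^ q) / 9)) := by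
  rw [vecOne_eq_centredVec,
    (integrable_and_absMoment_centredVec_self hindep hlaw (by positivity) hq).2]

/-- Up to symmetry a point of the centred sphere is `vecOne` or a generic `centredVec`. -/
lemma absMoment_cases (hindep : iIndepFun X P)
    (hlaw : ∀ i, HasLaw (X i) (expMeasure 1) P) {a : Fin 3 → ℝ} (ha : a ∈ centredSphere) :
    (∀ q, -1 < q → Integrable (absPow X q a) P ∧ absMoment P X q a = absMoment P X q vecOne) ∨
    ∃ α β : ℝ, 0 ≤ β ∧ β < α ∧ α ^ 2 + α * β + β ^ 2 = 1 / 2 ∧ ∀ q, -1 < q →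
      Integrable (absPow X q a) P ∧
      absMoment P X q a = Real.Gamma (q + 1) * genericMoment α β q := by
  obtain ⟨α, β, h0, h1, h2, h⟩ := exists_absMoment_eq_centredVec hindep hlaw ha
  rcases h1.eq_or_lt with rfl | h1
  · have hβ : β = 1 / √6 := by
      have := one_div_sqrt_sq (show (0 : ℝ) ≤ 6 by norm_num)
      refine (sq_eq_sq₀ h0 (by positivity)).1 ?_
      linarith
    have hβ0 : 0 < β := by rw [hβ]; positivity
    refine .inl fun q hq ↦ ⟨(h q).1
      (integrable_and_absMoment_centredVec_self hindep hlaw hβ0 hq).1, ?_⟩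
    rw [(h q).2, hβ, vecOne_eq_centredVec]
  · refine .inr ⟨α, β, h0, h1, h2, fun q hq ↦ ?_⟩
    have := integrable_and_absMoment_centredVec hindep hlaw h0 h1 hq
    exact ⟨(h q).1 this.1, (h q).2.trans this.2⟩

lemma absMoment_sub_mul_nonneg_of_pos (hindep : iIndepFun X P)
    (hlaw : ∀ i, HasLaw (X i) (expMeasure 1) P) {q : ℝ} (hq : -1 < q) {α β : ℝ}
    (hβ : 0 < β) (hαβ : β < α) (h : α ^ 2 + α * β + β ^ 2 = 1 / 2) :
    0 ≤ (Real.Gamma (q + 1) * genericMoment α β q - absMoment P X q vecTwo) *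
      (q * (q - 2) * (q - 4)) ∧
    0 ≤ (absMoment P X q vecOne - Real.Gamma (q + 1) * genericMoment α β q) *
      (q * (q - 2) * (q - 4)) := by
  have hΓ : 0 ≤ Real.Gamma (q + 1) := (Real.Gamma_pos_of_pos (by linarith)).le
  rw [absMoment_vecTwo hindep hlaw hq, absMoment_vecOne hindep hlaw hq, ← mul_sub, ← mul_sub,
    mul_assoc (Real.Gamma _), mul_assoc (Real.Gamma _)]
  exact ⟨mul_nonneg hΓ (genericMoment_sub_mul_nonneg hβ hαβ (by positivity)
      (one_div_sqrt_sq (by norm_num)) h q),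
    mul_nonneg hΓ (sub_genericMoment_mul_nonneg hβ hαβ (by positivity)
      (one_div_sqrt_sq (by norm_num)) h (by linarith))⟩

/-- Any point with 0 < β < α lies between the two vectors in both comparisons; adding these compares
the vectors themselves. -/
lemma absMoment_vecOne_sub_vecTwo_mul_nonneg (hindep : iIndepFun X P)
    (hlaw : ∀ i, HasLaw (X i) (expMeasure 1) P) {q : ℝ} (hq : -1 < q) :
    0 ≤ (absMoment P X q vecOne - absMoment P X q vecTwo) * (q * (q - 2) * (q - 4)) := by
  have h14 := one_div_sqrt_sq (show (0 : ℝ) ≤ 14 by norm_num)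
  have h0 : 0 < 1 / √14 := by positivity
  -- The intermediate point is (2, 1, -3)/√14.
  obtain ⟨h1, h2⟩ := absMoment_sub_mul_nonneg_of_pos hindep hlaw hq (α := 2 * (1 / √14)) h0
    (by linarith) (by linear_combination 7 * h14)
  linarith

lemma absMoment_sub_mul_nonneg (hindep : iIndepFun X P)
    (hlaw : ∀ i, HasLaw (X i) (expMeasure 1) P) {q : ℝ} (hq : -1 < q) {a : Fin 3 → ℝ}
    (ha : a ∈ centredSphere) :
    0 ≤ (absMoment P X q a - absMoment P X q vecTwo) * (q * (q - 2) * (q - 4)) ∧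
    0 ≤ (absMoment P X q vecOne - absMoment P X q a) * (q * (q - 2) * (q - 4)) := by
  have h12 := absMoment_vecOne_sub_vecTwo_mul_nonneg hindep hlaw hq
  rcases absMoment_cases hindep hlaw ha with h | ⟨α, β, h0, h1, h2, h⟩
  · rw [(h q hq).2]
    exact ⟨h12, by simp⟩
  · rw [(h q hq).2]
    -- The case β = 0 is separate because log β must be a genuine frequency; there the moment is
    -- that of `vecTwo`.
    rcases h0.eq_or_lt with rfl | h0
    · have hα : α = 1 / √2 := by
        refine (sq_eq_sq₀ h1.le (by positivity)).1 ?_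
        rw [one_div_sqrt_sq (by norm_num)]
        linarith
      rw [genericMoment_zero_right h1 (by linarith), hα, ← absMoment_vecTwo hindep hlaw hq]
      exact ⟨by simp, h12⟩
    · exact absMoment_sub_mul_nonneg_of_pos hindep hlaw hq h0 h1 h2

lemma absMoment_two (hindep : iIndepFun X P)
    (hlaw : ∀ i, HasLaw (X i) (expMeasure 1) P) {a : Fin 3 → ℝ} (ha : a ∈ centredSphere) :
    absMoment P X 2 a = Real.Gamma (2 + 1) * (1 / 2) := by
  rcases absMoment_cases hindep hlaw ha with h | ⟨α, β, h0, h1, h2, h⟩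
  · rw [(h 2 (by norm_num)).2, absMoment_vecOne hindep hlaw (by norm_num), Real.rpow_two,
      one_div_sqrt_sq (by norm_num)]
    norm_num
  · rw [(h 2 (by norm_num)).2, genericMoment_two h0 h1, h2]

lemma absMoment_four (hindep : iIndepFun X P)
    (hlaw : ∀ i, HasLaw (X i) (expMeasure 1) P) {a : Fin 3 → ℝ} (ha : a ∈ centredSphere) :
    absMoment P X 4 a = Real.Gamma (4 + 1) * (1 / 2) ^ 2 := by
  rcases absMoment_cases hindep hlaw ha with h | ⟨α, β, h0, h1, h2, h⟩
  · have h6 : (1 / √6) ^ 4 = 1 / 36 := by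
      rw [show (1 / √6) ^ 4 = ((1 / √6) ^ 2) ^ 2 by ring, one_div_sqrt_sq (by norm_num)]
      norm_num
    rw [(h 4 (by norm_num)).2, absMoment_vecOne hindep hlaw (by norm_num), Real.rpow_ofNat, h6]
    norm_num
  · rw [(h 4 (by norm_num)).2, genericMoment_four h0 h1, h2]

lemma attains_of_neg (hindep : iIndepFun X P)
    (hlaw : ∀ i, HasLaw (X i) (expMeasure 1) P) {q : ℝ} (hq : -1 < q)
    (h : q * (q - 2) * (q - 4) < 0) :
    AttainsMinAt (absMoment P X q) centredSphere vecOne ∧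
      AttainsMaxAt (absMoment P X q) centredSphere vecTwo := by
  refine ⟨⟨vecOne_mem, fun a ha ↦ ?_⟩, ⟨vecTwo_mem, fun a ha ↦ ?_⟩⟩
  · exact sub_nonpos.1 (nonpos_of_mul_nonneg_left
      (absMoment_sub_mul_nonneg hindep hlaw hq ha).2 h)
  · exact sub_nonpos.1 (nonpos_of_mul_nonneg_left
      (absMoment_sub_mul_nonneg hindep hlaw hq ha).1 h)

lemma attains_of_pos (hindep : iIndepFun X P)
    (hlaw : ∀ i, HasLaw (X i) (expMeasure 1) P) {q : ℝ} (hq : -1 < q)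
    (h : 0 < q * (q - 2) * (q - 4)) :
    AttainsMinAt (absMoment P X q) centredSphere vecTwo ∧
      AttainsMaxAt (absMoment P X q) centredSphere vecOne := by
  refine ⟨⟨vecTwo_mem, fun a ha ↦ ?_⟩, ⟨vecOne_mem, fun a ha ↦ ?_⟩⟩
  · exact sub_nonneg.1 (nonneg_of_mul_nonneg_left
      (absMoment_sub_mul_nonneg hindep hlaw hq ha).1 h)
  · exact sub_nonneg.1 (nonneg_of_mul_nonneg_left
      (absMoment_sub_mul_nonneg hindep hlaw hq ha).2 h)

end Extremal

theorem mainTheorem7 {Ω : Type*} [MeasurableSpace Ω] (P : Measure Ω) [IsProbabilityMeasure P]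
    (X : Fin 3 → Ω → ℝ) (hindep : iIndepFun X P)
    (hlaw : ∀ i, HasLaw (X i) (expMeasure 1) P) :
    -- all moments in question are genuine (finite) expectations
    (∀ q : ℝ, -1 < q → ∀ a ∈ centredSphere, Integrable (absPow X q a) P) ∧
    -- (i)
    (∀ q ∈ Set.Ioo (-1 : ℝ) 0 ∪ Set.Ioo 2 4,
      AttainsMinAt (absMoment P X q) centredSphere vecOne ∧
      AttainsMaxAt (absMoment P X q) centredSphere vecTwo) ∧
    -- (ii)
    (∀ q ∈ Set.Ioo (0 : ℝ) 2 ∪ Set.Ioo 4 6,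
      AttainsMinAt (absMoment P X q) centredSphere vecTwo ∧
      AttainsMaxAt (absMoment P X q) centredSphere vecOne) ∧
    -- (iii)
    (∀ k : ℕ, 3 < k →
      AttainsMinAt (absMoment P X (k : ℝ)) centredSphere vecTwo ∧
      AttainsMaxAt (absMoment P X (k : ℝ)) centredSphere vecOne) ∧
    -- (iv)
    (∃ c : ℝ, ∀ a ∈ centredSphere, absMoment P X 2 a = c) ∧
    (∃ c : ℝ, ∀ a ∈ centredSphere, absMoment P X 4 a = c) := by
  refine ⟨fun q hq a ha ↦ ?_, fun q hq ↦ ?_, fun q hq ↦ ?_, fun k hk ↦ ?_,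
    ⟨_, fun a ha ↦ absMoment_two hindep hlaw ha⟩, ⟨_, fun a ha ↦ absMoment_four hindep hlaw ha⟩⟩
  · rcases absMoment_cases hindep hlaw ha with h | ⟨_, _, _, _, _, h⟩
    · exact (h q hq).1
    · exact (h q hq).1
  · rcases hq with ⟨h1, h2⟩ | ⟨h1, h2⟩
    · exact attains_of_neg hindep hlaw h1 (mul_neg_of_pos_of_neg
        (mul_pos_of_neg_of_neg h2 (by linarith)) (by linarith))
    · exact attains_of_neg hindep hlaw (by linarith) (mul_neg_of_pos_of_neg
        (mul_pos (by linarith) (by linarith)) (by linarith))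
  · rcases hq with ⟨h1, h2⟩ | ⟨h1, h2⟩
    · exact attains_of_pos hindep hlaw (by linarith) (mul_pos_of_neg_of_neg
        (mul_neg_of_pos_of_neg h1 (by linarith)) (by linarith))
    · exact attains_of_pos hindep hlaw (by linarith)
        (mul_pos (mul_pos (by linarith) (by linarith)) (by linarith))
  -- For k = 4 the moment is constant, so every point of the sphere is extremal; for k > 4 the
  -- product k(k - 2)(k - 4) is positive.
  · rcases (Nat.succ_le_of_lt hk).eq_or_lt with rfl | hk
    · have h (a) (ha : a ∈ centredSphere) : absMoment P X ((Nat.succ 3 : ℕ) : ℝ) a =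
          Real.Gamma (4 + 1) * (1 / 2) ^ 2 := by
        rw [show ((Nat.succ 3 : ℕ) : ℝ) = 4 by norm_num]
        exact absMoment_four hindep hlaw ha
      exact ⟨⟨vecTwo_mem, fun a ha ↦ ((h _ vecTwo_mem).trans (h a ha).symm).le⟩,
        ⟨vecOne_mem, fun a ha ↦ ((h a ha).trans (h _ vecOne_mem).symm).le⟩⟩
    · have hk' : (4 : ℝ) < k := by exact_mod_cast hk
      exact attains_of_pos hindep hlaw (by linarith)
        (mul_pos (mul_pos (by linarith) (by linarith)) (by linarith))
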